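/- **Setting.** Let $\beta<-1$, $l_\beta=\frac{\beta}{1-\beta}$, $T_\beta(x)=\beta x-\lfloor\beta x-l_\beta\rfloor$ on $[l_\beta,l_\beta+1)$, and let $d=d(l_\beta,\beta)=d_1d_2\cdots$ with $d_i=\lfloor\beta T_\beta^{i-1}(l_\beta)-l_\beta\rfloor$. Write $l(x)$ for the length of a word $x$, $\varepsilon$ for the empty word, $X^*$ for the set of finite concatenations of words of $X$, $\sigma$ for the shift, and $\prec$ for the alternating order: $x\prec y$ iff for some $k\ge1$, $x_i=y_i$ for all $i<k$ and $(-1)^k(x_k-y_k)<0$. The following depends only on a sequence $d=d_1d_2\cdots$ of nonnegative integers. * $r=0d_1d_2\cdots$, except that $r=\overline{0\,d_1\cdots d_{m-1}(d_m-1)}$ if $d$ is purely periodic with an odd period, $m$ being the least one. $L=L(d)$ is the set of finite factors of the sequences $x$ with $d\preceq\sigma^k(x)\preceq r$ for all $k\ge0$. For $d=d(l_\beta,\beta)$ it is the language $L_\beta$ of the $\beta$-shift. * $n_0=p_0=0$; $n_{i+1}$ is the least $n\ge1$ with $2n\ge 2n_i+p_i$ and $d_{2n}=d_1$ ($n_{i+1}=\infty$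 if there is none), and $p_{i+1}\in\mathbb N\cup\{\infty\}$ is the length of the longest common prefix of $d_{2n}d_{2n+1}\cdots$ and $d_1d_2\cdots$ for $n=n_{i+1}$. For $i\ge1$ with $n_i<\infty$ put $B_i=d_1\cdots d_{2n_i-1}$; only such indices occur in the products of words $B_k$ below. * $D$ is the set of prefixes of $d$ of odd length; $E$ is the set of the words $B_i$; $\Delta_0^0=\{d_1\cdots d_{M}: M \text{ odd},\ 2n_i+p_i\le M<2n_{i+1}-1\text{ for some }i\ge0\}$; $\Gamma_0$ is the set of words $y=d_1\cdots d_nj\in L$ ($n\ge 0$, $j\ge 0$) with $d_1\cdots d_{n+1-i}\prec\sigma^i(y)$ for $0\le i\le n$. *First description:* $\mathfrak C=\{xy\in L: x\in\{\varepsilon\}\cup(D^*\cap L),\ y\in\Gamma_0\}$ and $\Delta_0=\{xy\in L: x\in\{\varepsilon\}\cup(E^*\cap L),\ y\in\Delta_0^0\}$. *Second, detailed description:* if $d_{2i}<d_1$ for all $i\ge1$, then $\Delta_0=D$ and $\Gamma=\{d_1\cdots d_nj: n\ge 0,\ 0\le j<d_1,\ (-1)^{n+1}(d_{n+1}-j)<0\}$.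 Otherwise $\Delta_0=\Delta_0^0\cup\Delta_0^1$ and $\Gamma=\Gamma_0\cup\Gamma_1\cup\Gamma_1'$, where $\Delta_0^1$ is the set of words $B_{k_1}\cdots B_{k_m}X$ with $m\ge1$, $p_{k_i}<2n_{k_{i+1}}-1$ for $i<m$, $X\in\Delta_0^0$, $l(X)>p_{k_m}$; $\Gamma_1$ is the set of words $B_{k_1}\cdots B_{k_m}y$ with $m\ge1$, $p_{k_i}<2n_{k_{i+1}}-1$ for $i<m$, $y\in\Gamma_0$, $l(y)\ge p_{k_m}+2$; and $\Gamma_1'$ is the set of words $B_{k_1}\cdots B_{k_{m-1}}y$ with $m\ge1$, $p_{k_i}<2n_{k_{i+1}}-1$ for $i\le m-2$, $y\in\Gamma_0$, $l(y)=2n_{k_m}+p_{k_m}$. In both cases $\mathfrak C=\{xy: x\in\Delta_0^*,\ y\in\Gamma,\ l(y)\ge2\}\cup\Gamma$. Finally let $\phi$ be the morphism $0\mapsto1$, $1\mapsto100$, let $u_n=\phi^n(1)$, $v_n=\phi^n(00)$, and let $\gamma_n>0$ be such that $1/\gamma_n$ is the smallest positive real $z$ with $1=z^{l(u_n)}+z^{l(v_n)}$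 (so $\gamma_0=\frac{1+\sqrt5}{2}$). **Lemma.** Let $\beta<-1$ and $d=d(l_\beta,\beta)$. 1. If $\beta<-\gamma_0$, then $\displaystyle\sum_{x\in\mathfrak C}\frac{l(x)}{|\beta|^{l(x)}}<+\infty$, for each of the two descriptions of $\mathfrak C=\mathfrak C(d)$. 2. If $n\ge0$ and $-\gamma_n\le\beta<-\gamma_{n+1}$, then there is exactly one sequence $e$ over $\{0,1\}$ with $d=\phi^n(e)$, and with $\Delta_n=\phi^n(\Delta_0(e))$ one has $\displaystyle\sum_{x\in\Delta_n}\frac{l(x)}{|\beta|^{l(x)}}<+\infty$, for each of the two descriptions of $\Delta_0(e)$. -/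

import Mathlib

open scoped Computability

namespace NegBeta

/-! ### Negative beta-expansions.  Sequences of digits are functions `a : ℕ → ℕ` indexed from `0`,
so that `a k` is the digit `d_{k+1}`. -/

/-- The left end point `l_β = β / (1 - β)` of the interval `I_β = [l_β, l_β + 1)` (for `β < -1`). -/
noncomputable def leftEnd (β : ℝ) : ℝ := β / (1 - β)

/-- The transformation `T_β x = β x - ⌊β x - l_β⌋`. -/
noncomputable def T (β x : ℝ) : ℝ := β * x - (⌊β * x - leftEnd β⌋ : ℝ)

/-- The expansion `d(l_β, β)` : the digit `d_{k+1}` is `⌊β T_β^k(l_β) - l_β⌋`, which is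
nonnegative. -/
noncomputable def expansion (β : ℝ) (k : ℕ) : ℕ :=
  ⌊β * (T β)^[k] (leftEnd β) - leftEnd β⌋₊

/-- The prefix `d_1 ⋯ d_k` of a sequence. -/
def pre (a : ℕ → ℕ) (k : ℕ) : List ℕ := (List.range k).map a

/-! ### The alternating order and admissible words -/

/-- Strict alternating order on sequences: at the first place `k` (counted from `1`) where `x` and
`y` differ, `(-1)^k (x_k - y_k) < 0`. -/
def altLT (x y : ℕ → ℕ) : Prop :=
  ∃ k, (∀ i < k, x i = y i) ∧ (-1 : ℤ) ^ (k + 1) * ((x k : ℤ) - (y k : ℤ)) < 0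

/-- Non-strict alternating order on sequences. -/
def altLE (x y : ℕ → ℕ) : Prop := altLT x y ∨ x = y

/-- Strict alternating order on finite words. -/
def altLTWord (u v : List ℕ) : Prop :=
  ∃ k, k < u.length ∧ k < v.length ∧ (∀ i < k, u.getD i 0 = v.getD i 0) ∧
    (-1 : ℤ) ^ (k + 1) * ((u.getD k 0 : ℤ) - (v.getD k 0 : ℤ)) < 0

/-- `a` is purely periodic with the odd period `m`. -/
def OddPeriod (a : ℕ → ℕ) (m : ℕ) : Prop := Odd m ∧ ∀ k, a (k + m) = a k

open Classical in
/-- The upper bound `(r_i)` attached to `a = (d_i)` : it is the sequence `0 d_1 d_2 ⋯`, except that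
it is the periodic repetition of `0 d_1 ⋯ d_{m-1} (d_m - 1)` when `a` is purely periodic with an odd
period, `m` being the least one. -/
noncomputable def upper (a : ℕ → ℕ) (k : ℕ) : ℕ :=
  if h : ∃ m, OddPeriod a m then
    if k % (Nat.find h + 1) = 0 then 0
    else if k % (Nat.find h + 1) = Nat.find h then a (Nat.find h - 1) - 1
    else a (k % (Nat.find h + 1) - 1)
  else if k = 0 then 0 else a (k - 1)

/-- The one-sided sequences all of whose tails lie between `a` and `upper a`.  For
`a = expansion β` these are the sequences of the `β`-shift `S_β`. -/
def shiftSpace (a : ℕ → ℕ) : Set (ℕ → ℕ) :=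
  {x | ∀ m, altLE a (fun i => x (m + i)) ∧ altLE (fun i => x (m + i)) (upper a)}

/-- The language of `shiftSpace a` (for `a = expansion β`, the language `L_β`). -/
def lang (a : ℕ → ℕ) : Language ℕ :=
  {w | ∃ x ∈ shiftSpace a, ∃ m, w = pre (fun i => x (m + i)) w.length}

/-! ### The sequences `(n_i)` and `(p_i)` -/

/-- Length of the longest common prefix of `a` and of its tail `a_N a_{N+1} ⋯`. -/
noncomputable def matchLen (a : ℕ → ℕ) (N : ℕ) : ℕ∞ :=
  sSup {p : ℕ∞ | ∃ q : ℕ, p = q ∧ ∀ m < q, a (N + m) = a m}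

/-- The pairs `(n_i, p_i)`.  One has `n_0 = p_0 = 0`; then `n_{i+1}` is the least `n ≥ 1` with
`2n ≥ 2 n_i + p_i` and `d_{2n} = d_1` (it is `⊤` if there is none), and `p_{i+1}` is the length of
the longest common prefix of `d_{2n} d_{2n+1} ⋯` and `d_1 d_2 ⋯`, where `n = n_{i+1}`.  Indices `i`
with `n_i = ⊤` carry no block; the value of `p_i` is then irrelevant. -/
noncomputable def np (a : ℕ → ℕ) : ℕ → ℕ∞ × ℕ∞
  | 0 => (0, 0)
  | i + 1 =>
    let n : ℕ∞ := sInf {n : ℕ∞ | ∃ m : ℕ, n = ((m + 1 : ℕ) : ℕ∞) ∧ a (2 * m + 1) = a 0 ∧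
      2 * (np a i).1 + (np a i).2 ≤ ((2 * (m + 1) : ℕ) : ℕ∞)}
    (n, matchLen a (2 * n.toNat - 1))

noncomputable def nSeq (a : ℕ → ℕ) (i : ℕ) : ℕ∞ := (np a i).1

noncomputable def pSeq (a : ℕ → ℕ) (i : ℕ) : ℕ∞ := (np a i).2

/-- The index `i` carries a block: `i ≥ 1` and `n_i` exists. -/
def Valid (a : ℕ → ℕ) (i : ℕ) : Prop := 1 ≤ i ∧ nSeq a i ≠ ⊤

/-- The word `B_i = d_1 ⋯ d_{2 n_i - 1}`. -/
noncomputable def B (a : ℕ → ℕ) (i : ℕ) : List ℕ := pre a (2 * (nSeq a i).toNat - 1)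

/-- The concatenation `B_{k_1} ⋯ B_{k_m}`. -/
noncomputable def Bprod (a : ℕ → ℕ) (ks : List ℕ) : List ℕ := (ks.map (B a)).flatten

/-- `k_1, …, k_m` are indices of blocks such that `p_{k_i} < 2 n_{k_{i+1}} - 1` for `1 ≤ i < m`. -/
def Linked (a : ℕ → ℕ) (ks : List ℕ) : Prop :=
  (∀ k ∈ ks, Valid a k) ∧ List.IsChain (fun k k' => pSeq a k + 1 < 2 * nSeq a k') ks

/-! ### The languages `D`, `E`, `Δ_0^0`, `Γ_0` -/

/-- All prefixes of odd length. -/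
def D (a : ℕ → ℕ) : Language ℕ := {w | ∃ k, w = pre a (2 * k + 1)}

/-- All the words `B_i`. -/
def E (a : ℕ → ℕ) : Language ℕ := {w | ∃ i, Valid a i ∧ w = B a i}

/-- The prefixes of odd length `M` such that `2 n_i + p_i ≤ M < 2 n_{i+1} - 1` for some `i ≥ 0`. -/
def Delta00 (a : ℕ → ℕ) : Language ℕ :=
  {w | ∃ M i : ℕ, Odd M ∧ 2 * nSeq a i + pSeq a i ≤ (M : ℕ∞) ∧
    (M : ℕ∞) + 1 < 2 * nSeq a (i + 1) ∧ w = pre a M}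

/-- The admissible words `y = d_1 ⋯ d_n j` with `d_1 ⋯ d_{n+1-i} ≺ σ^i(y)` for `0 ≤ i ≤ n`. -/
def Gamma0 (a : ℕ → ℕ) : Language ℕ :=
  {y | y ∈ lang a ∧ ∃ n j : ℕ, y = pre a n ++ [j] ∧
    ∀ i ≤ n, altLTWord (pre a (n + 1 - i)) (y.drop i)}

/-! ### First description of `ℭ` and of `Δ_0` -/

/-- `ℭ = {xy ∈ L | x ∈ {ε} ∪ (D* ∩ L), y ∈ Γ_0}`. -/
def codeC (a : ℕ → ℕ) : Language ℕ :=
  {w | w ∈ lang a ∧ ∃ x y, w = x ++ y ∧ (x = [] ∨ (x ∈ (D a)∗ ∧ x ∈ lang a)) ∧ y ∈ Gamma0 a}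

/-- `Δ_0 = {xy ∈ L | x ∈ {ε} ∪ (E* ∩ L), y ∈ Δ_0^0}`. -/
def Delta0 (a : ℕ → ℕ) : Language ℕ :=
  {w | w ∈ lang a ∧ ∃ x y, w = x ++ y ∧ (x = [] ∨ (x ∈ (E a)∗ ∧ x ∈ lang a)) ∧ y ∈ Delta00 a}

/-! ### Second, detailed description of `ℭ` and of `Δ_0` -/

/-- The words `B_{k_1} ⋯ B_{k_m} X`, `m ≥ 1`, with `p_{k_i} < 2 n_{k_{i+1}} - 1` for `i < m`,
`X ∈ Δ_0^0` and `l(X) > p_{k_m}`. -/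
def Delta01 (a : ℕ → ℕ) : Language ℕ :=
  {w | ∃ ks X, ks ≠ [] ∧ Linked a ks ∧ X ∈ Delta00 a ∧
    (∀ k ∈ ks.getLast?, pSeq a k < (X.length : ℕ∞)) ∧ w = Bprod a ks ++ X}

open Classical in
/-- The detailed `Δ_0` : all the odd prefixes if `d_{2i} < d_1` for all `i ≥ 1`, and
`Δ_0^0 ∪ Δ_0^1` otherwise. -/
noncomputable def Delta0' (a : ℕ → ℕ) : Language ℕ :=
  if ∀ i, a (2 * i + 1) < a 0 then D a else Delta00 a + Delta01 a

/-- The words `B_{k_1} ⋯ B_{k_m} y`, `m ≥ 1`, with `p_{k_i} < 2 n_{k_{i+1}} - 1` for `i < m`,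
`y ∈ Γ_0` and `l(y) ≥ p_{k_m} + 2`. -/
def Gamma1 (a : ℕ → ℕ) : Language ℕ :=
  {w | ∃ ks y, ks ≠ [] ∧ Linked a ks ∧ y ∈ Gamma0 a ∧
    (∀ k ∈ ks.getLast?, pSeq a k + 2 ≤ (y.length : ℕ∞)) ∧ w = Bprod a ks ++ y}

/-- The words `B_{k_1} ⋯ B_{k_{m-1}} y` with `p_{k_i} < 2 n_{k_{i+1}} - 1` for `i ≤ m - 2`,
`y ∈ Γ_0` and `l(y) = 2 n_{k_m} + p_{k_m}`. -/
def Gamma1' (a : ℕ → ℕ) : Language ℕ :=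
  {w | ∃ ks k y, Linked a ks ∧ Valid a k ∧ y ∈ Gamma0 a ∧
    (y.length : ℕ∞) = 2 * nSeq a k + pSeq a k ∧ w = Bprod a ks ++ y}

open Classical in
/-- `Γ = {d_1 ⋯ d_n j | (-1)^{n+1} (d_{n+1} - j) < 0, 0 ≤ j < d_1}` if `d_{2i} < d_1` for all
`i ≥ 1`, and `Γ = Γ_0 ∪ Γ_1 ∪ Γ_1'` otherwise. -/
noncomputable def Gamma (a : ℕ → ℕ) : Language ℕ :=
  if ∀ i, a (2 * i + 1) < a 0 then
    {w | ∃ n j : ℕ, j < a 0 ∧ (-1 : ℤ) ^ (n + 1) * ((a n : ℤ) - (j : ℤ)) < 0 ∧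
      w = pre a n ++ [j]}
  else Gamma0 a + Gamma1 a + Gamma1' a

/-- The detailed `ℭ = {xy | x ∈ Δ_0*, y ∈ Γ, l(y) ≥ 2} ∪ Γ`. -/
def codeC' (a : ℕ → ℕ) : Language ℕ :=
  {w | (∃ x y, x ∈ (Delta0' a)∗ ∧ y ∈ Gamma a ∧ 2 ≤ y.length ∧ w = x ++ y) ∨ w ∈ Gamma a}

/-! ### The morphism `φ`, the numbers `γ_n`, and `Δ_n = φ^n(Δ_0)` -/

/-- The morphism `φ` with `φ(0) = 1`, `φ(1) = 100` on words over `{0, 1}`. -/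
def phi (w : List ℕ) : List ℕ := w.flatMap fun t => if t = 0 then [1] else [1, 0, 0]

/-- `1 / γ_n` is the smallest positive real `z` with `1 = z^{l(u_n)} + z^{l(v_n)}`, where
`u_n = φ^n(1)` and `v_n = φ^n(00)`. -/
noncomputable def gam (n : ℕ) : ℝ :=
  (sInf {z : ℝ | 0 < z ∧ 1 = z ^ (phi^[n] [1]).length + z ^ (phi^[n] [0, 0]).length})⁻¹

/-- `e` is a sequence over `{0, 1}` with `φ^n(e) = d`. -/
def IsPreimage (n : ℕ) (d e : ℕ → ℕ) : Prop :=
  (∀ k, e k ≤ 1) ∧ ∀ k, phi^[n] (pre e k) = pre d (phi^[n] (pre e k)).length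

/-- The image under `φ^n` of the language `Δ e`, where `e` is the sequence with `φ^n(e) = d`. -/
def DeltaN (Δ : (ℕ → ℕ) → Language ℕ) (n : ℕ) (d : ℕ → ℕ) : Language ℕ :=
  {w | ∃ e, IsPreimage n d e ∧ ∃ v ∈ Δ e, w = phi^[n] v}

/-- `∑_{x ∈ C} l(x) / |β|^{l(x)} < ∞`. -/
def FiniteMean (β : ℝ) (C : Language ℕ) : Prop :=
  Summable fun x : {x : List ℕ // x ∈ C} => (x.1.length : ℝ) / |β| ^ x.1.length

end NegBeta

/-!
Each of the sums is bounded through the generating function of a free monoid.  Give a word `x` the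
weight `z ^ l(x)` and call the total weight of a language its mass; the mass of `S∗` is finite as
soon as the mass of `S` is less than `1` (`mass_kstar_ne_top`), and finite mass for one `z > 1 / |β|`
implies the finiteness of `∑ l(x) / |β| ^ l(x)` (`finiteMean_of_mass`).

For `β < -γ_0`, both descriptions of `ℭ` lie in `D∗` times the words `d_1 ⋯ d_n j` with `j < d_1`.
There is one word of `D` of each odd length, so `D` has mass `z / (1 - z²)`, which is less than `1`
exactly when `z + z² < 1`, that is, when `1 / z > γ_0`.

For `-γ_n ≤ β < -γ_{n+1}`, the preimage `e` comes from renormalization.  The translated orbit of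
`l_β` is an orbit in `[0, 1]` of a system with inverse branches `1 - C - A x` and `1 - C x`, where
`A = C = 1 / |β|` (`Orbit`).  If `A + C² ≥ 1` the word `101` cannot occur in the coding of such an
orbit, and if `A C² + A² ≥ 1` neither can `1000`, since the orbit would leave `[0, 1]`; then the
coding is a concatenation of blocks `100 = φ(1)` and `1 = φ(0)`, and the induced system is of the
same form with parameters `A C²` and `A` (`Orbit.renormalize`).  After `n` steps `A = |β| ^ (-l(u_n))`
and `C² = |β| ^ (-l(v_n))`, so the conditions are `|β| ≤ γ_n` and `|β| ≤ γ_{n+1}`.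

Finally, both descriptions of `Δ_0(e)` lie in `E(e)∗ D(e)`.  As `e` starts with `100` and has no factor
`101`, the weight of `φ^n(B_{i+1})` is at most that of `φ^n(B_i)` times that of `φ^n(11)`, so `φ^n(E(e))`
has mass at most `A C² / (1 - A²)`, now with `A = z ^ l(u_n)` and `C² = z ^ l(v_n)` (`mass_E_le`).  This is less
than `1` exactly when `z ^ l(u_{n+1}) + z ^ l(v_{n+1}) < 1`, that is, when `1 / z > γ_{n+1}`.
-/

open scoped ENNReal

namespace NegBeta

/-! ### Total weights of languages -/

/-- The total weight of the words of a language, for a weight function with values in `[0, ∞]`. -/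
noncomputable def mass (w : List ℕ → ℝ≥0∞) (S : Language ℕ) : ℝ≥0∞ :=
  ∑' x : {x : List ℕ // x ∈ S}, w x.1

lemma mass_mono (w : List ℕ → ℝ≥0∞) {S T : Language ℕ} (h : ∀ x ∈ S, x ∈ T) :
    mass w S ≤ mass w T :=
  ENNReal.tsum_comp_le_tsum_of_injective
    (f := fun x : {x : List ℕ // x ∈ S} => (⟨x.1, h x.1 x.2⟩ : {x : List ℕ // x ∈ T}))
    (fun x y hxy => Subtype.ext (by simpa using hxy)) (fun x => w x.1)

/-- A language enumerated (partially, possibly with repetitions) by `f` has at most the mass given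
by a majorant `g` of the weights. -/
lemma mass_le_tsum {ι : Type*} {w : List ℕ → ℝ≥0∞} {S : Language ℕ} (f : ι → List ℕ)
    (g : ι → ℝ≥0∞) (h : ∀ x ∈ S, ∃ i, f i = x ∧ w x ≤ g i) : mass w S ≤ ∑' i, g i := by
  choose i hi hg using fun x : {x : List ℕ // x ∈ S} => h x.1 x.2
  have hinj : Function.Injective i := fun x y hxy =>
    Subtype.ext (by rw [← hi x, ← hi y, hxy])
  exact (ENNReal.tsum_le_tsum hg).trans (ENNReal.tsum_comp_le_tsum_of_injective hinj g)

lemma mass_mul_le {w : List ℕ → ℝ≥0∞} (hw : ∀ x y, w (x ++ y) = w x * w y) (S T : Language ℕ) :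
    mass w (S * T) ≤ mass w S * mass w T := by
  have h := mass_le_tsum (w := w) (S := S * T)
    (fun p : {x : List ℕ // x ∈ S} × {x : List ℕ // x ∈ T} => p.1.1 ++ p.2.1)
    (fun p => w p.1.1 * w p.2.1) (by
      intro x hx
      obtain ⟨u, hu, v, hv, rfl⟩ := Language.mem_mul.1 hx
      exact ⟨(⟨u, hu⟩, ⟨v, hv⟩), rfl, (hw u v).le⟩)
  refine h.trans (le_of_eq ?_)
  rw [ENNReal.tsum_prod (f := fun (a : {x : List ℕ // x ∈ S}) (b : {x : List ℕ // x ∈ T}) =>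
    w a.1 * w b.1)]
  simp only [ENNReal.tsum_mul_left, ENNReal.tsum_mul_right, mass]

lemma mass_pow_le {w : List ℕ → ℝ≥0∞} (h1 : w [] = 1) (hw : ∀ x y, w (x ++ y) = w x * w y)
    (S : Language ℕ) (n : ℕ) : mass w (S ^ n) ≤ mass w S ^ n := by
  induction n with
  | zero =>
    have h := mass_le_tsum (w := w) (S := S ^ 0) (fun _ : Unit => []) (fun _ => 1) (by
      intro x hx
      rw [pow_zero, Language.mem_one] at hx
      exact ⟨(), hx.symm, by rw [hx, h1]⟩)
    simpa using h
  | succ n ih =>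
    rw [pow_succ, pow_succ]
    exact (mass_mul_le hw _ _).trans (by gcongr)

lemma mass_kstar_ne_top {w : List ℕ → ℝ≥0∞} (h1 : w [] = 1)
    (hw : ∀ x y, w (x ++ y) = w x * w y) {S : Language ℕ} (hS : mass w S < 1) :
    mass w (S∗) ≠ ⊤ := by
  have h := mass_le_tsum (w := w) (S := S∗)
    (fun p : (Σ n : ℕ, {x : List ℕ // x ∈ S ^ n}) => p.2.1) (fun p => w p.2.1) (by
      intro x hx
      rw [Language.kstar_eq_iSup_pow, Language.mem_iSup] at hx
      obtain ⟨n, hn⟩ := hx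
      exact ⟨⟨n, x, hn⟩, rfl, le_rfl⟩)
  rw [ENNReal.tsum_sigma (f := fun n (x : {x : List ℕ // x ∈ S ^ n}) => w x.1)] at h
  have h2 : ∑' n : ℕ, mass w (S ^ n) ≤ (1 - mass w S)⁻¹ := by
    rw [← ENNReal.tsum_geometric]
    exact ENNReal.tsum_le_tsum (mass_pow_le h1 hw S)
  refine ne_top_of_le_ne_top ?_ (h.trans h2)
  exact ENNReal.inv_ne_top.2 (tsub_pos_of_lt hS).ne'

/-- Convergence of the generating function at some point beyond `1 / |β|` gives a finite mean. -/
lemma finiteMean_of_mass {β z : ℝ} (hβ : β < -1) (hz : |β|⁻¹ < z) {S : Language ℕ}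
    (h : mass (fun x => ENNReal.ofReal z ^ x.length) S ≠ ⊤) : FiniteMean β S := by
  have hb : 0 < |β| := abs_pos.2 (by linarith)
  have hz0 : 0 < z := (inv_pos.2 hb).trans hz
  have hs : Summable fun x : {x : List ℕ // x ∈ S} => z ^ x.1.length := by
    have := ENNReal.summable_toReal h
    simpa [ENNReal.toReal_pow, ENNReal.toReal_ofReal hz0.le] using this
  have hr : |β|⁻¹ / z < 1 := (div_lt_one hz0).2 hz
  have ht := tendsto_self_mul_const_pow_of_lt_one (r := |β|⁻¹ / z) (by positivity) hr
  obtain ⟨K, hK⟩ := ht.bddAbove_range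
  refine Summable.of_nonneg_of_le (fun x => by positivity) (fun x => ?_) (hs.mul_left K)
  have h1 : (x.1.length : ℝ) * (|β|⁻¹ / z) ^ x.1.length ≤ K := hK ⟨_, rfl⟩
  have h2 : (x.1.length : ℝ) / |β| ^ x.1.length
      = (x.1.length : ℝ) * (|β|⁻¹ / z) ^ x.1.length * z ^ x.1.length := by
    rw [div_pow, inv_pow]; field_simp
  rw [h2]
  gcongr

/-! ### Prefixes -/

lemma pre_succ (a : ℕ → ℕ) (k : ℕ) : pre a (k + 1) = pre a k ++ [a k] := by
  simp [pre, List.range_succ]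

lemma length_pre (a : ℕ → ℕ) (k : ℕ) : (pre a k).length = k := by simp [pre]

lemma pre_add (a : ℕ → ℕ) (k m : ℕ) : pre a (k + m) = pre a k ++ pre (fun i => a (k + i)) m := by
  simp [pre, List.range_add]

/-! ### The morphism -/

lemma phi_append (u v : List ℕ) : phi (u ++ v) = phi u ++ phi v := by simp [phi]

lemma phi_iter_append (n : ℕ) (u v : List ℕ) :
    phi^[n] (u ++ v) = phi^[n] u ++ phi^[n] v := by
  induction n generalizing u v with
  | zero => rfl
  | succ n ih => rw [Function.iterate_succ_apply, phi_append, ih]; rfl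

lemma phi_iter_nil (n : ℕ) : phi^[n] [] = [] := by
  induction n with
  | zero => rfl
  | succ n ih => rw [Function.iterate_succ_apply]; exact ih

/-- The length of `φ^n(1)`. -/
def lenOne (n : ℕ) : ℕ := (phi^[n] [1]).length

/-- The length of `φ^n(0)`. -/
def lenZero (n : ℕ) : ℕ := (phi^[n] [0]).length

lemma length_iter_zero_zero (n : ℕ) : (phi^[n] [0, 0]).length = 2 * lenZero n := by
  rw [show [0, 0] = [0] ++ [0] from rfl, phi_iter_append, List.length_append, lenZero, two_mul]

lemma lenOne_succ (n : ℕ) : lenOne (n + 1) = lenOne n + 2 * lenZero n := by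
  rw [lenOne, Function.iterate_succ_apply, show phi [1] = [1] ++ [0, 0] from rfl,
    phi_iter_append, List.length_append, length_iter_zero_zero, lenOne]

lemma lenZero_succ (n : ℕ) : lenZero (n + 1) = lenOne n := by
  rw [lenZero, Function.iterate_succ_apply]; rfl

lemma lenZero_bounds (n : ℕ) :
    1 ≤ lenZero n ∧ lenZero n ≤ lenOne n ∧ lenOne n ≤ 3 * lenZero n := by
  induction n with
  | zero => simp [lenZero, lenOne]
  | succ n ih => rw [lenOne_succ, lenZero_succ]; omega

/-- A continuation of `φ^n(1)` and one of `φ^n(0x)` always differ.  Since `φ(1) = 100` and `φ(0x)`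
begins with `11`, cancelling the image of the first letter leads to the images of `00` and `1`
under a lower power of `φ`, with the two sides exchanged. -/
lemma phi_iter_one_ne_zero (n : ℕ) (x : ℕ) (u v p q : List ℕ) :
    phi^[n] (1 :: u) ++ p ≠ phi^[n] (0 :: x :: v) ++ q := by
  induction n generalizing x u v p q with
  | zero => simp
  | succ n ih =>
    intro h
    obtain ⟨v', hv'⟩ : ∃ v', phi (x :: v) = 1 :: v' := by
      by_cases hx : x = 0 <;> simp [phi, hx]
    rw [Function.iterate_succ_apply, Function.iterate_succ_apply,
      show phi (1 :: u) = [1] ++ 0 :: 0 :: phi u from rfl,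
      show phi (0 :: x :: v) = [1] ++ phi (x :: v) from rfl, hv', phi_iter_append,
      phi_iter_append, List.append_assoc, List.append_assoc, List.append_cancel_left_eq] at h
    exact ih 0 v' (phi u) q p h.symm

lemma IsPreimage.unique {n : ℕ} {d e f : ℕ → ℕ} (he : IsPreimage n d e) (hf : IsPreimage n d f) :
    e = f := by
  -- At the first disagreement, `φ^n(1)` and `φ^n(0x)` would both continue the same prefix of `d`.
  have key : ∀ e f : ℕ → ℕ, IsPreimage n d e → IsPreimage n d f → ∀ k, pre e k = pre f k →
      e k = 1 → f k = 0 → False := by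
    intro e f he hf k hk h1 h0
    have hE := he.2 (k + 1)
    have hF := hf.2 (k + 2)
    rw [pre_succ, h1, phi_iter_append] at hE
    rw [pre_succ, pre_succ, h0, List.append_assoc, phi_iter_append, ← hk] at hF
    obtain ⟨M, hM1, hM2⟩ : ∃ M, (phi^[n] (pre e k) ++ phi^[n] [1]).length ≤ M ∧
      (phi^[n] (pre e k) ++ phi^[n] ([0] ++ [f (k + 1)])).length ≤ M :=
      ⟨_, le_max_left _ _, le_max_right _ _⟩
    obtain ⟨p, hp⟩ := Nat.exists_eq_add_of_le hM1
    obtain ⟨q, hq⟩ := Nat.exists_eq_add_of_le hM2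
    have h := hp.symm.trans hq
    have h := congrArg (pre d) h
    rw [pre_add, pre_add, ← hE, ← hF, List.append_assoc, List.append_assoc,
      List.append_cancel_left_eq] at h
    exact phi_iter_one_ne_zero n _ _ _ _ _ h
  have hpre : ∀ k, pre e k = pre f k := by
    intro k
    induction k with
    | zero => rfl
    | succ k ih =>
      have h1 := he.1 k
      have h2 := hf.1 k
      have h3 := key e f he hf k ih
      have h4 := key f e hf he k ih.symm
      have : e k = f k := by
        have a1 : e k = 0 ∨ e k = 1 := by omega
        have a2 : f k = 0 ∨ f k = 1 := by omega
        rcases a1 with a1 | a1 <;> rcases a2 with a2 | a2 <;> simp_all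
      rw [pre_succ, pre_succ, ih, this]
  funext k
  have h := hpre (k + 1)
  rw [pre_succ, pre_succ, hpre k, List.append_cancel_left_eq] at h
  simpa using h

/-! ### The numbers `γ_n` -/

/-- `z^{l(u_n)} + z^{l(v_n)}`. -/
noncomputable def genPoly (n : ℕ) (z : ℝ) : ℝ := z ^ lenOne n + z ^ (2 * lenZero n)

lemma continuous_genPoly (n : ℕ) : Continuous (genPoly n) := by unfold genPoly; fun_prop

lemma genPoly_strictMonoOn (n : ℕ) : StrictMonoOn (genPoly n) (Set.Ici 0) := by
  intro x hx y _ hxy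
  have := lenZero_bounds n
  exact add_lt_add (pow_lt_pow_left₀ hxy hx (by omega)) (pow_lt_pow_left₀ hxy hx (by omega))

lemma gam_spec (n : ℕ) : 0 < gam n ∧ genPoly n (gam n)⁻¹ = 1 := by
  have hb := lenZero_bounds n
  obtain ⟨z, hz, hz1⟩ : (1 : ℝ) ∈ genPoly n '' Set.Icc 0 1 := by
    refine intermediate_value_Icc zero_le_one (continuous_genPoly n).continuousOn ⟨?_, ?_⟩
    · simp [genPoly, show lenOne n ≠ 0 by omega, show lenZero n ≠ 0 by omega]
    · norm_num [genPoly]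
  have hz0 : 0 < z := by
    rcases hz.1.eq_or_lt with h | h
    · subst h
      simp [genPoly, show lenOne n ≠ 0 by omega, show lenZero n ≠ 0 by omega] at hz1
    · exact h
  have hset : {z : ℝ | 0 < z ∧ 1 = z ^ (phi^[n] [1]).length + z ^ (phi^[n] [0, 0]).length}
      = {z} := by
    ext y
    rw [length_iter_zero_zero]
    constructor
    · rintro ⟨hy0, hy1⟩
      exact (genPoly_strictMonoOn n).injOn hy0.le hz0.le (hy1.symm.trans hz1.symm)
    · rintro rfl
      exact ⟨hz0, hz1.symm⟩
  have : gam n = z⁻¹ := by rw [gam, hset, csInf_singleton]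
  rw [this, inv_inv]
  exact ⟨inv_pos.2 hz0, hz1⟩

lemma genPoly_lt_one {n : ℕ} {b : ℝ} (h : gam n < b) : genPoly n b⁻¹ < 1 := by
  obtain ⟨h0, h1⟩ := gam_spec n
  rw [← h1]
  exact genPoly_strictMonoOn n (inv_pos.2 (h0.trans h)).le (inv_pos.2 h0).le
    (inv_strictAnti₀ h0 h)

lemma one_le_genPoly {n : ℕ} {b : ℝ} (hb : 0 < b) (h : b ≤ gam n) : 1 ≤ genPoly n b⁻¹ := by
  obtain ⟨h0, h1⟩ := gam_spec n
  rw [← h1]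
  exact (genPoly_strictMonoOn n).monotoneOn (inv_pos.2 h0).le (inv_pos.2 hb).le
    (inv_anti₀ hb h)

/-- The sequence `γ_n` decreases: with `A = z^{l(u_n)}` and `C = z^{l(φ^n(0))}` the polynomial of
index `n + 1` is `A C² + A² = A (A + C²)`. -/
lemma one_le_genPoly_of_succ {n : ℕ} {z : ℝ} (hz0 : 0 < z) (hz1 : z < 1)
    (h : 1 ≤ genPoly (n + 1) z) : 1 ≤ genPoly n z := by
  have hA : z ^ lenOne n ≤ 1 := pow_le_one₀ hz0.le hz1.le
  have hA0 : 0 < z ^ lenOne n := by positivity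
  have h2 : genPoly (n + 1) z = z ^ lenOne n * genPoly n z := by
    rw [genPoly, genPoly, lenOne_succ, lenZero_succ]; ring
  have hp : 0 < genPoly n z := by unfold genPoly; positivity
  rw [h2] at h
  exact h.trans (mul_le_of_le_one_left hp.le hA)

/-- There is room beyond `1 / b` when `b > γ_n`. -/
lemma exists_gt_genPoly_lt_one {n : ℕ} {b : ℝ} (h : gam n < b) :
    ∃ z, b⁻¹ < z ∧ genPoly n z < 1 := by
  have h1 : ∀ᶠ z in nhdsWithin b⁻¹ (Set.Ioi b⁻¹), genPoly n z < 1 :=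
    nhdsWithin_le_nhds ((continuous_genPoly n).continuousAt.eventually_lt
      continuousAt_const (genPoly_lt_one h))
  obtain ⟨z, hz1, hz2⟩ := (h1.and self_mem_nhdsWithin).exists
  exact ⟨z, hz2, hz1⟩

/-! ### Orbits of the two-branch systems and their renormalization -/

/-- `X` is the orbit of the left end point `0`, coded by the binary sequence `e`, of a system on
`[0, 1]` whose two inverse branches are `x ↦ 1 - C - A x` (letter `1`) and `x ↦ 1 - C x`
(letter `0`).  For `A = C = 1 / |β|` this is the orbit of `l_β` translated by `-l_β`. -/
structure Orbit (A C : ℝ) (e : ℕ → ℕ) (X : ℕ → ℝ) : Prop where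
  le_one : ∀ k, e k ≤ 1
  nonneg : ∀ k, 0 ≤ X k
  bound : ∀ k, X k ≤ 1
  start : X 0 = 0
  branch_one : ∀ k, e k = 1 → X k = 1 - C - A * X (k + 1)
  branch_zero : ∀ k, e k = 0 → X k = 1 - C * X (k + 1)

namespace Orbit

variable {A C : ℝ} {e : ℕ → ℕ} {X : ℕ → ℝ}

lemma eq_zero_or_one (h : Orbit A C e X) (k : ℕ) : e k = 0 ∨ e k = 1 := by
  have := h.le_one k; omega

lemma le_of_one (h : Orbit A C e X) (hA : 0 < A) {k : ℕ} (hk : e k = 1) : X k ≤ 1 - C := by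
  rw [h.branch_one k hk]
  have := mul_nonneg hA.le (h.nonneg (k + 1))
  linarith

lemma le_of_zero (h : Orbit A C e X) (hC : 0 < C) {k : ℕ} (hk : e k = 0) : 1 - C ≤ X k := by
  rw [h.branch_zero k hk]
  have := mul_le_mul_of_nonneg_left (h.bound (k + 1)) hC.le
  linarith

lemma code_zero (h : Orbit A C e X) (hC : 0 < C) (hC1 : C < 1) : e 0 = 1 := by
  rcases h.eq_zero_or_one 0 with h0 | h0
  · have := h.le_of_zero hC h0
    rw [h.start] at this
    linarith
  · exact h0

lemma code_one (h : Orbit A C e X) (hA : 0 < A) (hA1 : A < 1) (hC : 0 < C) (hC1 : C < 1) :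
    e 1 = 0 := by
  rcases h.eq_zero_or_one 1 with h1 | h1
  · exact h1
  · have h2 := h.branch_one 0 (h.code_zero hC hC1)
    rw [h.start] at h2
    have h3 := h.le_of_one hA h1
    simp only [zero_add] at h2
    nlinarith

/-- The word `101` does not occur: its image would lie to the left of `0`. -/
lemma no_one_zero_one (h : Orbit A C e X) (hA : 0 < A) (hC : 0 < C) (hC1 : C < 1)
    (hAC : 1 ≤ A + C ^ 2) {k : ℕ} (h0 : e k = 1) (h1 : e (k + 1) = 0) : e (k + 2) = 0 := by
  rcases h.eq_zero_or_one (k + 2) with h2 | h2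
  · exact h2
  · exfalso
    have b0 := h.branch_one k h0
    have b1 := h.branch_zero (k + 1) h1
    have b2 := h.le_of_one hA h2
    have b3 := h.nonneg k
    have c1 : 1 - C + C ^ 2 ≤ X (k + 1) := by
      have := mul_le_mul_of_nonneg_left b2 hC.le
      have e1 : k + 1 + 1 = k + 2 := rfl
      rw [e1] at b1
      linarith [this, b1, show C * (1 - C) = C - C ^ 2 by ring]
    have c2 : (1 - C ^ 2) * (1 - C + C ^ 2) ≤ A * X (k + 1) :=
      mul_le_mul (by linarith) c1 (by nlinarith) hA.le
    have c3 : 0 < (1 - C) * C ^ 3 := by have := sub_pos.2 hC1; positivity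
    nlinarith

/-- The word `1000` does not occur: its image would lie to the left of `0`. -/
lemma no_one_zero_zero_zero (h : Orbit A C e X) (hA : 0 < A) (hA1 : A < 1) (hC : 0 < C)
    (hC1 : C < 1) (hAC : 1 ≤ A * C ^ 2 + A ^ 2) {k : ℕ} (h0 : e k = 1) (h1 : e (k + 1) = 0)
    (h2 : e (k + 2) = 0) : e (k + 3) = 1 := by
  rcases h.eq_zero_or_one (k + 3) with h3 | h3
  · exfalso
    have b0 := h.branch_one k h0
    have b1 : X (k + 1) = 1 - C * X (k + 2) := h.branch_zero (k + 1) h1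
    have b2 : X (k + 2) = 1 - C * X (k + 3) := h.branch_zero (k + 2) h2
    have b3 := h.le_of_zero hC h3
    have b4 := h.nonneg k
    have c0 : X k = (1 - C) * (1 - A) - A * C ^ 2 * X (k + 3) := by
      rw [b0, b1, b2]; ring
    have c1 : A * C ^ 2 * (1 - C) ≤ A * C ^ 2 * X (k + 3) := by gcongr
    have c2 : A ^ 2 < A := by nlinarith
    have c3 : 0 < (1 - C) * (A + A * C ^ 2 - 1) := mul_pos (by linarith) (by linarith)
    nlinarith
  · exact h3

/-- If `A C² + A² ≥ 1`, then the coding sequence is the image under `φ` of a sequence that codes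
an orbit of the system with parameters `A C²` and `A`: the first return map to `[0, 1 - C]`,
rescaled, has the branches `100` and `1`. -/
lemma renormalize (h : Orbit A C e X) (hA : 0 < A) (hA1 : A < 1) (hC : 0 < C)
    (hC1 : C < 1) (hAC : 1 ≤ A * C ^ 2 + A ^ 2) :
    ∃ e' X', Orbit (A * C ^ 2) A e' X' ∧ ∀ k, ∃ m, phi (pre e' k) = pre e m := by
  have hAC' : 1 ≤ A + C ^ 2 := by
    have h0 : 0 < A + C ^ 2 := by positivity
    nlinarith
  have hD : 0 < 1 - C := by linarith
  -- `pos k` is the place where the `k`-th block of `e` begins.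
  let step : ℕ → ℕ := fun m => if e (m + 1) = 1 then m + 1 else m + 3
  let pos : ℕ → ℕ := fun k => step^[k] 0
  have pos_succ : ∀ k, pos (k + 1) = step (pos k) := fun k => Function.iterate_succ_apply' _ _ _
  have hstep : ∀ m, e m = 1 → e (step m) = 1 := by
    intro m hm
    by_cases h1 : e (m + 1) = 1
    · simp [step, h1]
    · have h1' : e (m + 1) = 0 := (h.eq_zero_or_one _).resolve_right h1
      have h2 := h.no_one_zero_one hA hC hC1 hAC' hm h1'
      simpa [step, h1'] using h.no_one_zero_zero_zero hA hA1 hC hC1 hAC hm h1' h2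
  have hpos : ∀ k, e (pos k) = 1 := by
    intro k
    induction k with
    | zero => exact h.code_zero hC hC1
    | succ k ih => rw [pos_succ]; exact hstep _ ih
  refine ⟨fun k => if e (pos k + 1) = 1 then 0 else 1, fun k => X (pos k) / (1 - C),
    ⟨fun k => by split_ifs <;> omega, fun k => div_nonneg (h.nonneg _) hD.le,
      fun k => (div_le_one hD).2 (h.le_of_one hA (hpos k)), ?_, fun k hk => ?_, fun k hk => ?_⟩,
    fun k => ⟨pos k, ?_⟩⟩
  · simp [pos, h.start]
  · have h1 : ¬ e (pos k + 1) = 1 := by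
      intro h1; simp [h1] at hk
    have h1' : e (pos k + 1) = 0 := (h.eq_zero_or_one _).resolve_right h1
    have h2 := h.no_one_zero_one hA hC hC1 hAC' (hpos k) h1'
    have hs : pos (k + 1) = pos k + 3 := by rw [pos_succ]; simp [step, h1']
    have b1 : X (pos k + 1) = 1 - C * X (pos k + 2) := h.branch_zero _ h1'
    have b2 : X (pos k + 2) = 1 - C * X (pos k + 3) := h.branch_zero _ h2
    rw [hs, h.branch_one _ (hpos k), b1, b2]
    field_simp
    ring
  · have h1 : e (pos k + 1) = 1 := by
      by_contra h1; simp [h1] at hk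
    have hs : pos (k + 1) = pos k + 1 := by rw [pos_succ]; simp [step, h1]
    rw [hs, h.branch_one _ (hpos k)]
    field_simp
  · induction k with
    | zero => rfl
    | succ k ih =>
      rw [pre_succ, phi_append, ih, pos_succ]
      by_cases h1 : e (pos k + 1) = 1
      · simp [step, h1, phi, pre_succ, hpos k]
      · have h1' : e (pos k + 1) = 0 := (h.eq_zero_or_one _).resolve_right h1
        have h2 := h.no_one_zero_one hA hC hC1 hAC' (hpos k) h1'
        simp [step, h1', h2, phi, pre_succ, hpos k]

end Orbit

/-- The expansion of `l_β` codes an orbit when `|β| < 2`. -/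
lemma orbit_expansion {β : ℝ} (h1 : β < -1) (h2 : -2 < β) :
    Orbit |β|⁻¹ |β|⁻¹ (expansion β) (fun k => (T β)^[k] (leftEnd β) - leftEnd β) := by
  have hβ : |β| = -β := abs_of_neg (by linarith)
  have hne : (1 - β) ≠ 0 := by linarith
  have hb0 : β ≠ 0 := by linarith
  have hl : leftEnd β * (1 - β) = β := div_mul_cancel₀ _ hne
  have hX : ∀ k, 0 ≤ (T β)^[k] (leftEnd β) - leftEnd β ∧
      (T β)^[k] (leftEnd β) - leftEnd β < 1 := by
    intro k
    cases k with
    | zero => simp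
    | succ k =>
      rw [Function.iterate_succ_apply', T]
      have e1 := Int.floor_le (β * (T β)^[k] (leftEnd β) - leftEnd β)
      have e2 := Int.lt_floor_add_one (β * (T β)^[k] (leftEnd β) - leftEnd β)
      constructor <;> linarith
  have hrec : ∀ k, (T β)^[k + 1] (leftEnd β) = β * (T β)^[k] (leftEnd β) - expansion β k := by
    intro k
    have hnn : 0 ≤ β * (T β)^[k] (leftEnd β) - leftEnd β := by
      have := (hX k).2
      nlinarith
    rw [Function.iterate_succ_apply', T, expansion, natCast_floor_eq_intCast_floor hnn]
  refine ⟨fun k => ?_, fun k => (hX k).1, fun k => (hX k).2.le, by simp, fun k hk => ?_,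
    fun k hk => ?_⟩
  · have a1 := hrec k
    have a2 := (hX (k + 1)).1
    have a3 := (hX k).1
    have : (expansion β k : ℝ) < 2 := by nlinarith
    have : expansion β k < 2 := by exact_mod_cast this
    omega
  · have a1 := hrec k
    rw [hk, Nat.cast_one] at a1
    rw [a1, hβ]
    field_simp
    nlinarith
  · have a1 := hrec k
    rw [hk, Nat.cast_zero] at a1
    rw [a1, hβ]
    field_simp
    nlinarith

lemma IsPreimage.succ {n : ℕ} {d e e' : ℕ → ℕ} (h : IsPreimage n d e) (he' : ∀ k, e' k ≤ 1)
    (hphi : ∀ k, ∃ m, phi (pre e' k) = pre e m) : IsPreimage (n + 1) d e' := by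
  refine ⟨he', fun k => ?_⟩
  obtain ⟨m, hm⟩ := hphi k
  rw [Function.iterate_succ_apply, hm]
  exact h.2 m

/-- If `|β| ≤ γ_n`, then the expansion of `l_β` can be renormalized `n` times. -/
lemma exists_orbit_isPreimage {β : ℝ} (hβ : β < -1) (n : ℕ) (h : 1 ≤ genPoly n |β|⁻¹) :
    ∃ e X, Orbit (|β|⁻¹ ^ lenOne n) (|β|⁻¹ ^ lenZero n) e X ∧
      IsPreimage n (expansion β) e := by
  have hb : 1 < |β| := by rw [abs_of_neg (by linarith)]; linarith
  have hz0 : 0 < |β|⁻¹ := inv_pos.2 (by linarith)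
  have hz1 : |β|⁻¹ < 1 := inv_lt_one_of_one_lt₀ hb
  induction n with
  | zero =>
    have h2 : -2 < β := by
      by_contra h2
      have : |β|⁻¹ ≤ 2⁻¹ := inv_anti₀ (by norm_num)
        (by rw [abs_of_neg (by linarith)]; linarith)
      simp only [genPoly, lenOne, lenZero, Function.iterate_zero, id, List.length_singleton] at h
      nlinarith
    have ho := orbit_expansion hβ h2
    refine ⟨expansion β, fun k => (T β)^[k] (leftEnd β) - leftEnd β, ?_, ho.le_one, fun k => ?_⟩
    · simpa [lenOne, lenZero] using ho
    · simp [length_pre]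
  | succ n ih =>
    obtain ⟨e, X, ho, hp⟩ := ih (one_le_genPoly_of_succ hz0 hz1 h)
    have hn := lenZero_bounds n
    have hpow : |β|⁻¹ ^ lenOne n * (|β|⁻¹ ^ lenZero n) ^ 2 = |β|⁻¹ ^ lenOne (n + 1) := by
      rw [lenOne_succ]; ring
    obtain ⟨e', X', ho', hphi⟩ := ho.renormalize (by positivity)
      (pow_lt_one₀ hz0.le hz1 (by omega)) (by positivity) (pow_lt_one₀ hz0.le hz1 (by omega)) (by
        rw [hpow]
        rw [genPoly, lenZero_succ] at h
        rw [← pow_mul, mul_comm (lenOne n) 2]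
        exact h)
    rw [hpow] at ho'
    rw [lenZero_succ]
    exact ⟨e', X', ho', hp.succ ho'.le_one hphi⟩

/-! ### Convergence for `β < -γ_0` -/

/-- The words `d_1 ⋯ d_n j` with `j < d_1`. -/
def prefixLetter (a : ℕ → ℕ) : Language ℕ := {w | ∃ n j : ℕ, j < a 0 ∧ w = pre a n ++ [j]}

lemma mem_prefixLetter_of_mem_Gamma0 {a : ℕ → ℕ} {y : List ℕ} (h : y ∈ Gamma0 a) :
    y ∈ prefixLetter a := by
  obtain ⟨-, n, j, rfl, h⟩ := h
  obtain ⟨k, hk, -, -, hlt⟩ := h n le_rfl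
  rw [length_pre] at hk
  have hk0 : k = 0 := by omega
  subst hk0
  have hd : (pre a n ++ [j]).drop n = [j] := by
    rw [List.drop_append_of_le_length (by simp [length_pre]),
      List.drop_of_length_le (by simp [length_pre]), List.nil_append]
  rw [hd, show n + 1 - n = 1 by omega, show pre a 1 = [a 0] from rfl] at hlt
  simp at hlt
  exact ⟨n, j, hlt, rfl⟩

/-- When `n_{i+1}` is finite, the infimum that defines it is attained. -/
lemma nSeq_succ_spec {a : ℕ → ℕ} {i : ℕ} (h : nSeq a (i + 1) ≠ ⊤) :
    ∃ m : ℕ, nSeq a (i + 1) = ((m + 1 : ℕ) : ℕ∞) ∧ a (2 * m + 1) = a 0 ∧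
      2 * nSeq a i + pSeq a i ≤ ((2 * (m + 1) : ℕ) : ℕ∞) := by
  have hne : {n : ℕ∞ | ∃ m : ℕ, n = ((m + 1 : ℕ) : ℕ∞) ∧ a (2 * m + 1) = a 0 ∧
      2 * (np a i).1 + (np a i).2 ≤ ((2 * (m + 1) : ℕ) : ℕ∞)}.Nonempty := by
    rw [Set.nonempty_iff_ne_empty]
    intro h0
    apply h
    show sInf _ = _
    rw [h0, sInf_empty]
  exact csInf_mem hne

lemma E_le_D (a : ℕ → ℕ) : E a ≤ D a := by
  rintro _ ⟨i, ⟨hi, hv⟩, rfl⟩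
  obtain ⟨i, rfl⟩ := Nat.exists_eq_add_of_le' hi
  obtain ⟨m, hm, -⟩ := nSeq_succ_spec hv
  refine ⟨m, ?_⟩
  rw [B, hm, ENat.toNat_natCast]
  congr 1

lemma Bprod_mem_kstar {a : ℕ → ℕ} {ks : List ℕ} (h : ∀ k ∈ ks, Valid a k) :
    Bprod a ks ∈ (E a)∗ := by
  refine Language.mem_kstar.2 ⟨ks.map (B a), rfl, fun y hy => ?_⟩
  obtain ⟨k, hk, rfl⟩ := List.mem_map.1 hy
  exact ⟨k, h k hk, rfl⟩

lemma append_mem_kstar {S : Language ℕ} {x y : List ℕ} (hx : x ∈ S∗) (hy : y ∈ S∗) :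
    x ++ y ∈ S∗ := by
  rw [← kstar_mul_kstar S]
  exact Language.append_mem_mul hx hy

lemma Delta00_le_D (a : ℕ → ℕ) : Delta00 a ≤ D a := by
  rintro _ ⟨M, i, ⟨k, rfl⟩, -, -, rfl⟩
  exact ⟨k, rfl⟩

lemma Delta0'_le (a : ℕ → ℕ) : Delta0' a ≤ (E a)∗ * D a := by
  intro w hw
  by_cases h : ∀ i, a (2 * i + 1) < a 0
  · rw [Delta0', if_pos h] at hw
    exact Language.append_mem_mul (Language.nil_mem_kstar _) hw
  · rw [Delta0', if_neg h] at hw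
    rcases (Language.mem_add _ _ _).1 hw with hw | ⟨ks, X, -, hks, hX, -, rfl⟩
    · exact Language.append_mem_mul (Language.nil_mem_kstar _) (Delta00_le_D a hw)
    · exact Language.append_mem_mul (Bprod_mem_kstar hks.1) (Delta00_le_D a hX)

lemma Delta0_le (a : ℕ → ℕ) : Delta0 a ≤ (E a)∗ * D a := by
  rintro _ ⟨-, x, y, rfl, hx, hy⟩
  refine Language.append_mem_mul ?_ (Delta00_le_D a hy)
  rcases hx with rfl | hx
  · exact Language.nil_mem_kstar _
  · exact hx.1

lemma codeC_le (a : ℕ → ℕ) : codeC a ≤ (D a)∗ * prefixLetter a := by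
  rintro _ ⟨-, x, y, rfl, hx, hy⟩
  refine Language.append_mem_mul ?_ (mem_prefixLetter_of_mem_Gamma0 hy)
  rcases hx with rfl | hx
  · exact Language.nil_mem_kstar _
  · exact hx.1

lemma Gamma_le (a : ℕ → ℕ) : Gamma a ≤ (D a)∗ * prefixLetter a := by
  have hE : (E a)∗ ≤ (D a)∗ := kstar_mono (E_le_D a)
  intro w hw
  by_cases h : ∀ i, a (2 * i + 1) < a 0
  · have hG : Gamma a = _ := if_pos h
    rw [hG] at hw
    obtain ⟨n, j, hj, -, rfl⟩ := hw
    exact Language.mem_mul.2 ⟨[], Language.nil_mem_kstar _, _, ⟨n, j, hj, rfl⟩, rfl⟩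
  · have hG : Gamma a = _ := if_neg h
    rw [hG] at hw
    rcases (Language.mem_add _ _ _).1 hw with hw | ⟨ks, k, y, hks, -, hy, -, rfl⟩
    · rcases (Language.mem_add _ _ _).1 hw with hw | ⟨ks, y, -, hks, hy, -, rfl⟩
      · exact Language.append_mem_mul (Language.nil_mem_kstar _)
          (mem_prefixLetter_of_mem_Gamma0 hw)
      · exact Language.append_mem_mul (hE (Bprod_mem_kstar hks.1))
          (mem_prefixLetter_of_mem_Gamma0 hy)
    · exact Language.append_mem_mul (hE (Bprod_mem_kstar hks.1))
        (mem_prefixLetter_of_mem_Gamma0 hy)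

lemma codeC'_le (a : ℕ → ℕ) : codeC' a ≤ (D a)∗ * prefixLetter a := by
  have hΔ : (Delta0' a)∗ ≤ (D a)∗ := by
    have h1 : (E a)∗ * D a ≤ (D a)∗ := fun w hw => by
      obtain ⟨x, hx, y, hy, rfl⟩ := Language.mem_mul.1 hw
      exact append_mem_kstar (kstar_mono (E_le_D a) hx) ((le_kstar : D a ≤ (D a)∗) hy)
    exact (kstar_mono ((Delta0'_le a).trans h1)).trans (kstar_idem _).le
  rintro w (⟨x, y, hx, hy, -, rfl⟩ | hw)
  · obtain ⟨u, hu, v, hv, rfl⟩ := Language.mem_mul.1 (Gamma_le a hy)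
    rw [← List.append_assoc]
    exact Language.append_mem_mul (append_mem_kstar (hΔ hx) hu) hv
  · exact Gamma_le a hw

lemma mass_D_le (a : ℕ → ℕ) (z : ℝ≥0∞) :
    mass (fun x => z ^ x.length) (D a) ≤ z * (1 - z ^ 2)⁻¹ := by
  rw [← ENNReal.tsum_geometric, ← ENNReal.tsum_mul_left]
  refine mass_le_tsum (fun k => pre a (2 * k + 1)) _ ?_
  rintro _ ⟨k, rfl⟩
  refine ⟨k, rfl, le_of_eq ?_⟩
  rw [length_pre]; ring

lemma mass_prefixLetter_ne_top (a : ℕ → ℕ) {z : ℝ≥0∞} (hz : z < 1) :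
    mass (fun x => z ^ x.length) (prefixLetter a) ≠ ⊤ := by
  have h := mass_le_tsum (w := fun x => z ^ x.length) (S := prefixLetter a)
    (fun p : Fin (a 0) × ℕ => pre a p.2 ++ [p.1.1]) (fun p => z * z ^ p.2) (by
      rintro _ ⟨n, j, hj, rfl⟩
      refine ⟨(⟨j, hj⟩, n), rfl, le_of_eq ?_⟩
      simp [length_pre, pow_succ']
    )
  refine ne_top_of_le_ne_top ?_ h
  rw [ENNReal.tsum_prod (f := fun _ n => z * z ^ n)]
  simp only [ENNReal.tsum_mul_left, ENNReal.tsum_geometric, tsum_fintype, Finset.sum_const,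
    nsmul_eq_mul]
  exact ENNReal.mul_ne_top (by simp) (ENNReal.mul_ne_top (hz.trans ENNReal.one_lt_top).ne
    (ENNReal.inv_ne_top.2 (tsub_pos_of_lt hz).ne'))

lemma mul_inv_one_sub_lt_one {p q : ℝ≥0∞} (h : p + q < 1) : p * (1 - q)⁻¹ < 1 := by
  rw [← div_eq_mul_inv]
  have h2 : p < 1 - q := lt_tsub_iff_right.2 h
  refine (ENNReal.div_lt_iff (Or.inl (pos_of_gt h2).ne')
    (Or.inl (ne_top_of_le_ne_top ENNReal.one_ne_top tsub_le_self))).2 ?_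
  simpa using h2

lemma finiteMean_of_le_kstar_D {β : ℝ} (hβ : β < -1) (h : β < -gam 0) {S : Language ℕ}
    {a : ℕ → ℕ} (hS : S ≤ (D a)∗ * prefixLetter a) : FiniteMean β S := by
  have hb : gam 0 < |β| := by rw [abs_of_neg (by linarith)]; linarith
  obtain ⟨z, hz, hz1⟩ := exists_gt_genPoly_lt_one hb
  have hz0 : 0 < z := (inv_pos.2 ((gam_spec 0).1.trans hb)).trans hz
  have hlt : ENNReal.ofReal z + ENNReal.ofReal z ^ 2 < 1 := by
    rw [← ENNReal.ofReal_pow hz0.le, ← ENNReal.ofReal_add hz0.le (by positivity),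
      ENNReal.ofReal_lt_one]
    simpa [genPoly, lenOne, lenZero] using hz1
  refine finiteMean_of_mass hβ hz (ne_top_of_le_ne_top ?_
    ((mass_mono _ hS).trans (mass_mul_le (fun x y => by simp [pow_add]) _ _)))
  exact ENNReal.mul_ne_top (mass_kstar_ne_top (by simp) (fun x y => by simp [pow_add])
    ((mass_D_le a _).trans_lt (mul_inv_one_sub_lt_one hlt)))
    (mass_prefixLetter_ne_top a (lt_of_le_of_lt le_self_add hlt))

/-! ### Convergence for the renormalized sequences -/

lemma le_matchLen {a : ℕ → ℕ} {N q : ℕ} (h : ∀ m < q, a (N + m) = a m) :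
    (q : ℕ∞) ≤ matchLen a N := le_sSup ⟨q, rfl, h⟩

lemma pSeq_succ {a : ℕ → ℕ} {i m : ℕ} (h : nSeq a (i + 1) = ((m + 1 : ℕ) : ℕ∞)) :
    pSeq a (i + 1) = matchLen a (2 * m + 1) := by
  show matchLen a (2 * (nSeq a (i + 1)).toNat - 1) = _
  rw [h, ENat.toNat_natCast]
  congr 1

/-- The weight of `B_{i+1}` decreases at least like `A^{2i}`.  Between two consecutive blocks `e`
reads `11⋯`, or else `100` and at least one more letter since the next block starts after the end
of the common prefix. -/
lemma weight_B_le {w : List ℕ → ℝ≥0∞} (h1 : w [] = 1) (hw : ∀ x y, w (x ++ y) = w x * w y)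
    {e : ℕ → ℕ} (he : ∀ k, e k ≤ 1) (he0 : e 0 = 1) (he1 : e 1 = 0)
    (he2 : ∀ k, e k = 1 → e (k + 1) = 0 → e (k + 2) = 0)
    (hA : w [1] ≤ w [0]) (hC : w [0] ≤ 1) (hCA : w [0] ^ 3 ≤ w [1]) (i : ℕ)
    (hi : nSeq e (i + 1) ≠ ⊤) : w (B e (i + 1)) ≤ w [1] * w [0] ^ 2 * (w [1] ^ 2) ^ i := by
  have hlet : ∀ k, w [e k] ≤ w [0] := by
    intro k
    have := he k
    have : e k = 0 ∨ e k = 1 := by omega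
    rcases this with h | h <;> rw [h]
    exact hA
  have hanti : ∀ k m, w (pre e (k + m)) ≤ w (pre e k) := by
    intro k m
    induction m with
    | zero => rfl
    | succ m ih =>
      rw [← add_assoc, pre_succ, hw]
      exact (mul_le_of_le_one_right' ((hlet _).trans hC)).trans ih
  have hle : ∀ k m, k ≤ m → w (pre e m) ≤ w (pre e k) := by
    intro k m hkm
    obtain ⟨r, rfl⟩ := Nat.exists_eq_add_of_le hkm
    exact hanti k r
  induction i with
  | zero =>
    obtain ⟨m, hm, hem, -⟩ := nSeq_succ_spec hi
    have hm0 : m ≠ 0 := by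
      rintro rfl
      simp [he0, he1] at hem
    rw [B, hm, ENat.toNat_natCast]
    refine (hle 3 _ (by omega)).trans (le_of_eq ?_)
    have he2' : e 2 = 0 := he2 0 he0 he1
    rw [pre_succ, pre_succ, pre_succ, hw, hw, hw, he0, he1, he2']
    simp [pre, h1]; ring
  | succ i ih =>
    obtain ⟨m, hm, hem, hmle⟩ := nSeq_succ_spec hi
    have hi' : nSeq e (i + 1) ≠ ⊤ := by
      intro h
      rw [h, ENat.mul_top (by norm_num), top_add] at hmle
      exact ENat.natCast_ne_top _ (top_le_iff.1 hmle)
    obtain ⟨m', hm', hem', -⟩ := nSeq_succ_spec hi'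
    have ih := ih hi'
    rw [B, hm', ENat.toNat_natCast, show 2 * (m' + 1) - 1 = 2 * m' + 1 by omega] at ih
    rw [B, hm, ENat.toNat_natCast, show 2 * (m + 1) - 1 = 2 * m + 1 by omega]
    rw [hm', pSeq_succ hm'] at hmle
    rw [he0] at hem'
    have hmatch : ∀ q : ℕ, (∀ r < q, e (2 * m' + 1 + r) = e r) →
        2 * (m' + 1) + q ≤ 2 * (m + 1) := by
      intro q hq
      have h2 := (add_le_add_right (le_matchLen hq) (2 * ((m' + 1 : ℕ) : ℕ∞))).trans hmle
      exact_mod_cast h2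
    have hgoal : w (pre e (2 * m + 1)) ≤ w (pre e (2 * m' + 1)) * w [1] ^ 2 := by
      have e2 : e (2 * m' + 2) = 0 ∨ e (2 * m' + 2) = 1 := by
        have := he (2 * m' + 2); omega
      rcases e2 with e2 | e2
      · have e3 : e (2 * m' + 3) = 0 := he2 _ hem' e2
        have hq := hmatch 3 (by
          intro r hr
          interval_cases r
          · simp [hem', he0]
          · simpa [he1] using e2
          · have := he2 0 he0 he1
            simp only [zero_add] at this
            rw [this]; exact e3)
        refine (hle (2 * m' + 1 + 1 + 1 + 1 + 1) _ (by omega)).trans ?_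
        rw [pre_succ, pre_succ, pre_succ, pre_succ, hw, hw, hw, hw, hem',
          show 2 * m' + 1 + 1 = 2 * m' + 2 from rfl, show 2 * m' + 2 + 1 = 2 * m' + 3 from rfl,
          e2, e3]
        calc w (pre e (2 * m' + 1)) * w [1] * w [0] * w [0] * w [e (2 * m' + 3 + 1)]
            ≤ w (pre e (2 * m' + 1)) * w [1] * w [0] * w [0] * w [0] := by
              gcongr; exact hlet _
          _ = w (pre e (2 * m' + 1)) * (w [1] * w [0] ^ 3) := by ring
          _ ≤ w (pre e (2 * m' + 1)) * (w [1] * w [1]) := by gcongr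
          _ = _ := by ring
      · have hq := hmatch 1 (by
          intro r hr
          interval_cases r
          simp [hem', he0])
        refine (hle (2 * m' + 1 + 1 + 1) _ (by omega)).trans (le_of_eq ?_)
        rw [pre_succ, pre_succ, hw, hw, hem', show 2 * m' + 1 + 1 = 2 * m' + 2 from rfl, e2]
        ring
    calc w (pre e (2 * m + 1)) ≤ w (pre e (2 * m' + 1)) * w [1] ^ 2 := hgoal
      _ ≤ w [1] * w [0] ^ 2 * (w [1] ^ 2) ^ i * w [1] ^ 2 := by gcongr
      _ = _ := by ring

lemma mass_E_le {w : List ℕ → ℝ≥0∞} (h1 : w [] = 1) (hw : ∀ x y, w (x ++ y) = w x * w y)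
    {e : ℕ → ℕ} (he : ∀ k, e k ≤ 1) (he0 : e 0 = 1) (he1 : e 1 = 0)
    (he2 : ∀ k, e k = 1 → e (k + 1) = 0 → e (k + 2) = 0)
    (hA : w [1] ≤ w [0]) (hC : w [0] ≤ 1) (hCA : w [0] ^ 3 ≤ w [1]) :
    mass w (E e) ≤ w [1] * w [0] ^ 2 * (1 - w [1] ^ 2)⁻¹ := by
  rw [← ENNReal.tsum_geometric, ← ENNReal.tsum_mul_left]
  refine mass_le_tsum (fun i => B e (i + 1)) _ ?_
  rintro _ ⟨i, ⟨hi, hv⟩, rfl⟩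
  obtain ⟨i, rfl⟩ := Nat.exists_eq_add_of_le' hi
  exact ⟨i, rfl, weight_B_le h1 hw he he0 he1 he2 hA hC hCA i hv⟩

lemma length_le_length_phi_iter (n : ℕ) (x : List ℕ) : x.length ≤ (phi^[n] x).length := by
  induction n generalizing x with
  | zero => rfl
  | succ n ih =>
    rw [Function.iterate_succ_apply]
    refine le_trans ?_ (ih _)
    induction x with
    | nil => simp
    | cons t x ihx =>
      rw [show phi (t :: x) = phi [t] ++ phi x from phi_append [t] x, List.length_append,
        List.length_cons]
      by_cases ht : t = 0 <;> simp [phi, ht] at ihx ⊢ <;> omega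

lemma finiteMean_DeltaN {β : ℝ} (hβ : β < -1) {n : ℕ} (h1 : -gam n ≤ β) (h2 : β < -gam (n + 1))
    {Δ : (ℕ → ℕ) → Language ℕ} (hΔ : ∀ e, Δ e ≤ (E e)∗ * D e) :
    FiniteMean β (DeltaN Δ n (expansion β)) := by
  have habs : |β| = -β := abs_of_neg (by linarith)
  have hb0 : 0 < |β| := by rw [habs]; linarith
  have hb1 : 1 < |β| := by rw [habs]; linarith
  have hge : 1 ≤ genPoly n |β|⁻¹ := one_le_genPoly hb0 (by rw [habs]; linarith)
  obtain ⟨e, X, ho, hp⟩ := exists_orbit_isPreimage hβ n hge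
  obtain ⟨z, hz, hlt⟩ := exists_gt_genPoly_lt_one (n := n + 1) (b := |β|) (by rw [habs]; linarith)
  have hy0 : 0 < |β|⁻¹ := inv_pos.2 hb0
  have hy1 : |β|⁻¹ < 1 := inv_lt_one_of_one_lt₀ hb1
  have hz0 : 0 < z := hy0.trans hz
  have hn := lenZero_bounds n
  have hz1 : z < 1 := by
    by_contra hz1
    have : 1 ≤ z ^ lenOne (n + 1) := one_le_pow₀ (not_lt.1 hz1)
    have : 0 ≤ z ^ (2 * lenZero (n + 1)) := by positivity
    rw [genPoly] at hlt
    linarith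
  set ζ := ENNReal.ofReal z with hζ
  have hζ1 : ζ < 1 := ENNReal.ofReal_lt_one.2 hz1
  have hlt' : (ζ ^ lenOne n) * (ζ ^ lenZero n) ^ 2 + (ζ ^ lenOne n) ^ 2 < 1 := by
    have : (ζ ^ lenOne n) * (ζ ^ lenZero n) ^ 2 + (ζ ^ lenOne n) ^ 2
        = ENNReal.ofReal (genPoly (n + 1) z) := by
      rw [genPoly, ENNReal.ofReal_add (by positivity) (by positivity),
        ENNReal.ofReal_pow hz0.le, ENNReal.ofReal_pow hz0.le, ← hζ, lenOne_succ, lenZero_succ]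
      ring
    rw [this]
    exact ENNReal.ofReal_lt_one.2 hlt
  let w : List ℕ → ℝ≥0∞ := fun x => ζ ^ (phi^[n] x).length
  have hw1 : w [] = 1 := by simp [w, phi_iter_nil]
  have hw : ∀ x y, w (x ++ y) = w x * w y := by
    intro x y; simp [w, phi_iter_append, pow_add]
  have hC0 : 0 < |β|⁻¹ ^ lenZero n := by positivity
  have hC1 : |β|⁻¹ ^ lenZero n < 1 := pow_lt_one₀ hy0.le hy1 (by omega)
  have hA0 : 0 < |β|⁻¹ ^ lenOne n := by positivity
  have hA1 : |β|⁻¹ ^ lenOne n < 1 := pow_lt_one₀ hy0.le hy1 (by omega)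
  have hE : mass w (E e) < 1 := by
    refine (mass_E_le hw1 hw ho.le_one (ho.code_zero hC0 hC1) (ho.code_one hA0 hA1 hC0 hC1)
      (fun k => ho.no_one_zero_one hA0 hC0 hC1 ?_) ?_ ?_ ?_).trans_lt
      (mul_inv_one_sub_lt_one hlt')
    · rw [← pow_mul, mul_comm (lenZero n) 2]; exact hge
    · exact pow_le_pow_right_of_le_one' hζ1.le hn.2.1
    · exact pow_le_one' hζ1.le _
    · show (ζ ^ lenZero n) ^ 3 ≤ ζ ^ lenOne n
      rw [← pow_mul]
      exact pow_le_pow_right_of_le_one' hζ1.le (by omega)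
  have hD : mass w (D e) ≠ ⊤ := by
    have h := mass_le_tsum (w := w) (S := D e) (fun k => pre e (2 * k + 1)) (fun k => ζ ^ k) (by
      rintro _ ⟨k, rfl⟩
      refine ⟨k, rfl, pow_le_pow_right_of_le_one' hζ1.le ?_⟩
      have := length_le_length_phi_iter n (pre e (2 * k + 1))
      rw [length_pre] at this
      omega)
    rw [ENNReal.tsum_geometric] at h
    exact ne_top_of_le_ne_top (ENNReal.inv_ne_top.2 (tsub_pos_of_lt hζ1).ne') h
  have hfin : mass w (Δ e) ≠ ⊤ :=
    ne_top_of_le_ne_top (ENNReal.mul_ne_top (mass_kstar_ne_top hw1 hw hE) hD)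
      ((mass_mono w (hΔ e)).trans (mass_mul_le hw _ _))
  refine finiteMean_of_mass hβ hz (ne_top_of_le_ne_top hfin ?_)
  refine mass_le_tsum (fun v : {v : List ℕ // v ∈ Δ e} => phi^[n] v.1) (fun v => w v.1) ?_
  rintro _ ⟨f, hf, v, hv, rfl⟩
  have hfe := hf.unique hp
  subst hfe
  exact ⟨⟨v, hv⟩, rfl, le_rfl⟩

end NegBeta

theorem mainTheorem7 (β : ℝ) (hβ : β < -1) :
    (β < -NegBeta.gam 0 →
      NegBeta.FiniteMean β (NegBeta.codeC (NegBeta.expansion β)) ∧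
      NegBeta.FiniteMean β (NegBeta.codeC' (NegBeta.expansion β))) ∧
    (∀ n : ℕ, -NegBeta.gam n ≤ β → β < -NegBeta.gam (n + 1) →
      (∃! e : ℕ → ℕ, NegBeta.IsPreimage n (NegBeta.expansion β) e) ∧
      NegBeta.FiniteMean β (NegBeta.DeltaN NegBeta.Delta0 n (NegBeta.expansion β)) ∧
      NegBeta.FiniteMean β (NegBeta.DeltaN NegBeta.Delta0' n (NegBeta.expansion β))) := by
  refine ⟨fun h => ⟨NegBeta.finiteMean_of_le_kstar_D hβ h (NegBeta.codeC_le _),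
    NegBeta.finiteMean_of_le_kstar_D hβ h (NegBeta.codeC'_le _)⟩, fun n h1 h2 => ⟨?_,
    NegBeta.finiteMean_DeltaN hβ h1 h2 NegBeta.Delta0_le,
    NegBeta.finiteMean_DeltaN hβ h1 h2 NegBeta.Delta0'_le⟩⟩
  have habs : |β| = -β := abs_of_neg (by linarith)
  obtain ⟨e, -, -, hp⟩ := NegBeta.exists_orbit_isPreimage hβ n
    (NegBeta.one_le_genPoly (by rw [habs]; linarith) (by rw [habs]; linarith))
  exact ⟨e, hp, fun f hf => hf.unique hp⟩
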